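/- Let $\{x\}$ denote the fractional part of $x$, $\gamma$ Euler's constant, and let $B_1,B_2$ be the Bernoulli functions of period $1$: $B_1(x)=\{x\}-\tfrac12$ if $x\notin\mathbb Z$, $B_1(x)=0$ if $x\in\mathbb Z$, and $B_2(x)=\{x\}^2-\{x\}+\tfrac16$. Put $$A(\lambda)=\int_0^{\infty}\{t\}\{\lambda t\}\,\frac{dt}{t^2}\quad(\lambda>0),\qquad \varphi_1(x)=\sum_{k\ge1}\frac{B_1(kx)}{k},\qquad \varphi_2(x)=\sum_{k\ge1}\frac{B_2(kx)}{k^2},$$ where $\varphi_1(x)$ is defined at the points $x$ where its series, summed in the natural order, converges. The series for $\varphi_1$ converges for almost every real $x$ and the series for $\varphi_2$ converges for every real $x$. For every $\lambda>0$ the integral defining $A(\lambda)$ and the integrals below converge absolutely, and $$A(\lambda)=\frac12\log\lambda+\frac{1-\gamma+\log 2\pi}{2}-\lambda\int_\lambda^{\infty}\varphi_1(t)\,\frac{dt}{t^2},$$ and also $$A(\lambda)=\frac12\log\lambda+\frac{1-\gamma+\log 2\pi}{2}+\frac{\varphi_2(\lambda)}{2\lambda}-\lambda\int_\lambda^{\infty}\varphi_2(t)\,\frac{dt}{t^3}.$$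 -/

import Mathlib

open Filter Topology MeasureTheory

noncomputable section

/-- The `n`-th Bernoulli function: the `1`-periodic function equal to the Bernoulli polynomial
`b_n` evaluated at the fractional part of `x`, except that for `n = 1` its value at the integers
is `0`. -/
def bernoulliPer (n : ℕ) (x : ℝ) : ℝ :=
  if n = 1 ∧ Int.fract x = 0 then 0 else bernoulliFun n (Int.fract x)

/-- The partial sum `∑_{1 ≤ k ≤ K} B_n(k x) / k ^ n`. -/
def phiPartial (n : ℕ) (x : ℝ) (K : ℕ) : ℝ :=
  ∑ k ∈ Finset.Icc 1 K, bernoulliPer n ((k : ℝ) * x) / (k : ℝ) ^ n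

/-- `φ_n(x) = ∑_{k ≥ 1} B_n(k x) / k ^ n`, the limit of the partial sums in their natural order.
(For `n = 1` the series need not converge absolutely; the value is meaningful at every point of
convergence.) -/
def phi (n : ℕ) (x : ℝ) : ℝ :=
  limUnder atTop (phiPartial n x)

/-- The multiplicative autocorrelation of the fractional part function,
`A(lam) = ∫_0^∞ {t} {lam t} t ^ (-2) dt`. -/
def fractAutocorr (lam : ℝ) : ℝ :=
  ∫ t in Set.Ioi (0 : ℝ), Int.fract t * Int.fract (lam * t) / t ^ 2

end

/-!
Write `s(x) = {x} - 1/2`, which agrees with `B_1` off the integers. Neither the almost everywhere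
statements nor the integrals see the difference, because `k t` is never an integer for irrational
`t`; so the proof works with the partial sums `sawBlock 0 K t = ∑_{k ≤ K} s(k t) / k`.

*Convergence.* The multiplication formula `∑_{r < n} s(x + r / n) = s(n x)` gives
`∫_0^1 s(j x) s(k x) dx = gcd(j, k)^2 / (12 j k)`. Since
`∑_{j, k ≤ N} gcd(j, k)^2 ≤ ∑_{d ≤ N} d^2 ⌊N / d⌋^2 ≤ N^3`, the block `M < k ≤ N` has mean square at
most `N^3 / (12 M^4)`. Along the fourth powers the `L^1` norms of the blocks are therefore summable,
and between consecutive fourth powers the partial sums vary by `o(1)`. This yields convergence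
almost everywhere together with a periodic integrable function `sawBlockSum` dominating the partial
sums along the fourth powers (`ae_tendsto_sawBlock_phi_one`), so that `φ_1` may be integrated term
by term along them (`integrableOn_phi_one_and_tendsto`):
`lam ∫_lam^∞ φ_1(t) t^(-2) dt = lim lam ∑_{k ≤ K} h(k lam)`, with `h(y) = ∫_y^∞ s(u) u^(-2) du`.

*The formulas.* Substituting `t = u / lam` and writing `{u / lam} = u / lam - #{k ≥ 1 : k lam ≤ u}`,
the integral truncated at `u = K lam` equals
`∫_0^{K lam} {u} / u du - lam ∑_{k ≤ K} h(k lam) - H_K / 2 + K lam h(K lam) + 1/2`,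
where `H_K` is the harmonic number. Stirling's formula in the form
`∫_0^X {u} / u du = (log X) / 2 + (log 2π) / 2 + o(1)`, the asymptotics of `H_K` and
`h(y) = O(y^(-2))` give the limit of `lam ∑_{k ≤ K} h(k lam)` (`tendsto_sum_sawTail`),
hence the first formula.
Integration by parts, `h(y) = -B_2(y) / (2 y^2) + ∫_y^∞ B_2(u) u^(-3) du` (`sawTail_eq`), turns it
into the second one, where the interchange is harmless because the series of `φ_2` converges
uniformly.
-/

/-! ### The sawtooth function -/

/-- The sawtooth `{x} - 1 / 2`. It agrees with the first Bernoulli function off the integers and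
satisfies the multiplication formula at every point. -/
noncomputable def saw (x : ℝ) : ℝ := Int.fract x - 1 / 2

lemma saw_add_one (x : ℝ) : saw (x + 1) = saw x := by simp [saw]

lemma saw_add_natCast (x : ℝ) (n : ℕ) : saw (x + n) = saw x := by simp [saw]

lemma abs_saw_le (x : ℝ) : |saw x| ≤ 1 / 2 := by
  have h0 := Int.fract_nonneg x
  have h1 := Int.fract_lt_one x
  rw [abs_le, saw]
  constructor <;> linarith

@[fun_prop]
lemma measurable_saw : Measurable saw := measurable_fract.sub_const _

lemma saw_of_mem_Ico {x : ℝ} (hx : x ∈ Set.Ico (0 : ℝ) 1) : saw x = x - 1 / 2 := by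
  rw [saw, Int.fract_eq_self.2 hx]

/-- Multiplication formula: both sides are `1 / n`-periodic and agree on `[0, 1 / n)`. -/
lemma sum_saw_add_div (n : ℕ) (hn : 0 < n) (x : ℝ) :
    ∑ r ∈ Finset.range n, saw (x + r / n) = saw (n * x) := by
  have hn' : (0 : ℝ) < n := by exact_mod_cast hn
  have hper : Function.Periodic
      (fun x : ℝ => ∑ r ∈ Finset.range n, saw (x + r / n) - saw (n * x)) (1 / n : ℝ) := by
    intro y
    have h1 : (n : ℝ) * (y + 1 / n) = n * y + 1 := by field_simp
    have h2 : ∑ r ∈ Finset.range n, saw (y + 1 / n + r / n)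
        = ∑ r ∈ Finset.range n, saw (y + r / n) := by
      have h3 : ∀ r : ℕ, saw (y + 1 / n + r / n) = saw (y + (r + 1 : ℕ) / n) := by
        intro r
        congr 1
        push_cast
        ring
      have h4 := Finset.sum_range_succ (fun r : ℕ => saw (y + r / n)) n
      rw [Finset.sum_range_succ'] at h4
      rw [Finset.sum_congr rfl fun r _ => h3 r]
      have h5 : saw (y + (n : ℝ) / n) = saw (y + (0 : ℕ) / n) := by
        rw [div_self hn'.ne', saw_add_one]
        simp
      linarith
    simp only [h1, h2, saw_add_one]
  obtain ⟨y, hy, hxy⟩ := hper.exists_mem_Ico₀ (by positivity) x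
  have hny : (n : ℝ) * y < 1 := by
    have := hy.2
    rwa [lt_div_iff₀ hn', mul_comm] at this
  have hsum : ∑ r ∈ Finset.range n, saw (y + r / n) = saw (n * y) := by
    rw [saw_of_mem_Ico ⟨mul_nonneg hn'.le hy.1, hny⟩]
    have h1 : ∀ r ∈ Finset.range n, saw (y + r / n) = (y - 1 / 2) + (r : ℝ) * (1 / n) := by
      intro r hr
      have hr' : (r : ℝ) + 1 ≤ n := by exact_mod_cast Finset.mem_range.1 hr
      rw [saw_of_mem_Ico]
      · ring
      · refine ⟨add_nonneg hy.1 (by positivity), ?_⟩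
        have : y + r / n = (n * y + r) / n := by field_simp
        rw [this, div_lt_one hn']
        linarith
    have h2 : (∑ r ∈ Finset.range n, (r : ℝ)) = n * (n - 1) / 2 := by
      clear h1 hny hxy hy hper hn' hn
      induction n with
      | zero => simp
      | succ m ih => rw [Finset.sum_range_succ, ih]; push_cast; ring
    rw [Finset.sum_congr rfl h1, Finset.sum_add_distrib, ← Finset.sum_mul, h2]
    simp
    field_simp
    ring
  simp only [hsum, sub_self] at hxy
  linarith

/-- For `b` prime to `a`, the points `b r / a` run over all residues `r / a` modulo `1`. -/
lemma sum_saw_add_mul_div (a b : ℕ) (ha : 0 < a) (hab : a.Coprime b) (y : ℝ) :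
    ∑ r ∈ Finset.range a, saw (y + b * r / a) = saw (a * y) := by
  have ha' : (a : ℝ) ≠ 0 := by exact_mod_cast ha.ne'
  rw [← sum_saw_add_div a ha y]
  have hmaps : Set.MapsTo (fun r => b * r % a) (Finset.range a : Set ℕ) (Finset.range a) := by
    intro r _
    simpa using Nat.mod_lt _ ha
  have hinj : Set.InjOn (fun r => b * r % a) (Finset.range a : Set ℕ) := by
    intro r hr s hs hrs
    have h1 : r ≡ s [MOD a] := Nat.ModEq.cancel_left_of_coprime hab hrs
    exact Nat.ModEq.eq_of_lt_of_lt h1 (by simpa using hr) (by simpa using hs)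
  refine Finset.sum_nbij (fun r => b * r % a) hmaps hinj
    (Finset.surjOn_of_injOn_of_card_le _ hmaps hinj le_rfl) ?_
  intro r _
  have h1 : ((b : ℝ) * r) = ((b * r % a : ℕ) : ℝ) + a * ((b * r / a : ℕ) : ℝ) := by
    exact_mod_cast (Nat.mod_add_div (b * r) a).symm
  rw [h1, add_div, mul_div_cancel_left₀ _ ha', ← add_assoc, saw_add_natCast]

/-! ### Correlations of dilated sawtooth functions -/

lemma intervalIntegrable_of_measurable_of_abs_le {f : ℝ → ℝ} (hf : Measurable f) {C : ℝ}
    (hC : ∀ x, |f x| ≤ C) (a b : ℝ) : IntervalIntegrable f volume a b :=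
  (intervalIntegrable_const (c := C)).mono_fun hf.aestronglyMeasurable
    (Eventually.of_forall fun x => by
      simpa [abs_of_nonneg ((abs_nonneg _).trans (hC x))] using hC x)

lemma intervalIntegrable_saw_mul_saw (j k c d a b : ℝ) :
    IntervalIntegrable (fun x => saw (j * x + c) * saw (k * x + d)) volume a b := by
  refine intervalIntegrable_of_measurable_of_abs_le (by fun_prop) (C := 1 / 2 * (1 / 2)) ?_ a b
  intro x
  rw [abs_mul]
  exact mul_le_mul (abs_saw_le _) (abs_saw_le _) (abs_nonneg _) (by norm_num)

lemma integral_comp_natCast_mul_of_periodic {F : ℝ → ℝ} (hF : Function.Periodic F 1)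
    (hint : ∀ a b, IntervalIntegrable F volume a b) {n : ℕ} (hn : 0 < n) :
    ∫ x in (0 : ℝ)..1, F (n * x) = ∫ x in (0 : ℝ)..1, F x := by
  have hn' : (n : ℝ) ≠ 0 := by exact_mod_cast hn.ne'
  rw [intervalIntegral.integral_comp_mul_left F hn']
  have h := hF.intervalIntegral_add_zsmul_eq (n : ℤ) 0
  simp only [zsmul_eq_mul, Int.cast_natCast, mul_one, zero_add] at h
  rw [mul_zero, mul_one, h hint]
  simp [hn']

/-- Averaging over the translates by `r / a` turns the factor `saw (b x)` into `saw (a b x) / a`. -/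
lemma integral_saw_mul_saw_of_coprime (a b : ℕ) (ha : 0 < a) (hab : a.Coprime b) :
    ∫ x in (0 : ℝ)..1, saw (a * x) * saw (b * x)
      = 1 / a * ∫ x in (0 : ℝ)..1, saw x * saw (b * x) := by
  have ha' : (a : ℝ) ≠ 0 := by exact_mod_cast ha.ne'
  have hper : Function.Periodic (fun x : ℝ => saw (a * x) * saw (b * x)) 1 := by
    intro x
    simp only [mul_add, mul_one, saw_add_natCast]
  have hshift : ∀ r : ℕ, ∫ x in (0 : ℝ)..1, saw (a * x) * saw (b * x + b * r / a)
      = ∫ x in (0 : ℝ)..1, saw (a * x) * saw (b * x) := by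
    intro r
    have h1 := hper.intervalIntegral_add_eq (r / a : ℝ) 0
    rw [zero_add, add_comm, ← zero_add (r / a : ℝ), add_comm (1 : ℝ), zero_add,
      show (r / a : ℝ) + 1 = 1 + r / a by ring] at h1
    have h2 := intervalIntegral.integral_comp_add_right (a := 0) (b := 1)
      (fun x : ℝ => saw (a * x) * saw (b * x)) (r / a : ℝ)
    rw [zero_add, h1] at h2
    rw [← h2]
    congr 1
    ext x
    rw [show (a : ℝ) * (x + r / a) = a * x + r by field_simp, saw_add_natCast]
    congr 2
    ring
  have hsum : ∫ x in (0 : ℝ)..1, saw (a * x) * saw (b * (a * x))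
      = a * ∫ x in (0 : ℝ)..1, saw (a * x) * saw (b * x) := by
    calc ∫ x in (0 : ℝ)..1, saw (a * x) * saw (b * (a * x))
        = ∫ x in (0 : ℝ)..1, ∑ r ∈ Finset.range a, saw (a * x) * saw (b * x + b * r / a) := by
          congr 1
          ext x
          rw [← Finset.mul_sum, sum_saw_add_mul_div a b ha hab]
          congr 2
          ring
      _ = ∑ r ∈ Finset.range a, ∫ x in (0 : ℝ)..1, saw (a * x) * saw (b * x + b * r / a) := by
          refine intervalIntegral.integral_finsetSum fun r _ => ?_
          simpa using intervalIntegrable_saw_mul_saw a b 0 (b * r / a) 0 1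
      _ = _ := by simp [hshift]
  have hscale := integral_comp_natCast_mul_of_periodic (F := fun x => saw x * saw (b * x))
    (fun x => by simp only [mul_add, mul_one, saw_add_natCast, saw_add_one])
    (fun u v => by simpa using intervalIntegrable_saw_mul_saw 1 b 0 0 u v) ha
  rw [← hscale, hsum, one_div, inv_mul_cancel_left₀ ha']

lemma integral_saw_mul_saw_self : ∫ x in (0 : ℝ)..1, saw x * saw x = 1 / 12 := by
  have h : ∫ x in (0 : ℝ)..1, saw x * saw x = ∫ x in (0 : ℝ)..1, (x ^ 2 - x + 1 / 4) := by
    refine intervalIntegral.integral_congr_ae ?_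
    have h1 : ∀ᵐ x : ℝ, x ≠ 1 := by simp [ae_iff]
    filter_upwards [h1] with x hx hx'
    rw [Set.uIoc_of_le zero_le_one] at hx'
    rw [saw_of_mem_Ico ⟨hx'.1.le, lt_of_le_of_ne hx'.2 hx⟩]
    ring
  rw [h, intervalIntegral.integral_add, intervalIntegral.integral_sub] <;>
    norm_num [integral_pow]

lemma integral_saw_natCast_mul_mul_saw (j k : ℕ) (hj : 0 < j) (hk : 0 < k) :
    ∫ x in (0 : ℝ)..1, saw (j * x) * saw (k * x) = (j.gcd k : ℝ) ^ 2 / (12 * j * k) := by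
  obtain ⟨a, b, hab, hja, hkb⟩ := Nat.exists_coprime j k
  set g := j.gcd k with hg
  have hg0 : 0 < g := Nat.gcd_pos_of_pos_left _ hj
  have ha : 0 < a := Nat.pos_of_ne_zero (by rintro rfl; simp at hja; omega)
  have hb : 0 < b := Nat.pos_of_ne_zero (by rintro rfl; simp at hkb; omega)
  have hscale := integral_comp_natCast_mul_of_periodic (F := fun x => saw (a * x) * saw (b * x))
    (fun x => by simp only [mul_add, mul_one, saw_add_natCast])
    (fun u v => by simpa using intervalIntegrable_saw_mul_saw a b 0 0 u v) hg0
  have hj' : (j : ℝ) = a * g := by exact_mod_cast hja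
  have hk' : (k : ℝ) = b * g := by exact_mod_cast hkb
  have h1 := integral_saw_mul_saw_of_coprime b 1 hb (Nat.coprime_one_right b)
  simp only [Nat.cast_one, one_mul] at h1
  have h2 : ∫ x in (0 : ℝ)..1, saw x * saw (b * x) = ∫ x in (0 : ℝ)..1, saw (b * x) * saw x := by
    simp only [mul_comm]
  have h3 : ∫ x in (0 : ℝ)..1, saw (j * x) * saw (k * x)
      = ∫ x in (0 : ℝ)..1, saw (a * (g * x)) * saw (b * (g * x)) := by
    simp only [hj', hk', mul_assoc]
  have ha' : (a : ℝ) ≠ 0 := by exact_mod_cast ha.ne'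
  have hb' : (b : ℝ) ≠ 0 := by exact_mod_cast hb.ne'
  have hg' : (g : ℝ) ≠ 0 := by exact_mod_cast hg0.ne'
  rw [h3, hscale, integral_saw_mul_saw_of_coprime a b ha hab, h2, h1, integral_saw_mul_saw_self,
    hj', hk']
  field_simp

/-- Since `gcd (j, k) ^ 2` is at most the sum of `d ^ 2` over the common divisors `d` of `j` and
`k`, the double sum is at most `∑_{d ≤ N} d ^ 2 ⌊N / d⌋ ^ 2`. -/
lemma sum_gcd_sq_le (N : ℕ) :
    ∑ j ∈ Finset.Ioc 0 N, ∑ k ∈ Finset.Ioc 0 N, (j.gcd k) ^ 2 ≤ N ^ 3 := by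
  have h1 : ∀ j ∈ Finset.Ioc 0 N, ∀ k ∈ Finset.Ioc 0 N, (j.gcd k) ^ 2 ≤
      ∑ d ∈ Finset.Ioc 0 N, (if d ∣ j then 1 else 0) * (if d ∣ k then 1 else 0) * d ^ 2 := by
    intro j hj k hk
    rw [Finset.mem_Ioc] at hj hk
    have hmem : j.gcd k ∈ Finset.Ioc 0 N :=
      Finset.mem_Ioc.2 ⟨Nat.gcd_pos_of_pos_left _ hj.1, (Nat.gcd_le_left _ hj.1).trans hj.2⟩
    refine le_trans ?_ (Finset.single_le_sum (fun _ _ => Nat.zero_le _) hmem)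
    simp [Nat.gcd_dvd_left, Nat.gcd_dvd_right]
  calc ∑ j ∈ Finset.Ioc 0 N, ∑ k ∈ Finset.Ioc 0 N, (j.gcd k) ^ 2
      ≤ ∑ j ∈ Finset.Ioc 0 N, ∑ k ∈ Finset.Ioc 0 N, ∑ d ∈ Finset.Ioc 0 N,
          (if d ∣ j then 1 else 0) * (if d ∣ k then 1 else 0) * d ^ 2 :=
        Finset.sum_le_sum fun j hj => Finset.sum_le_sum fun k hk => h1 j hj k hk
    _ = ∑ d ∈ Finset.Ioc 0 N, (∑ j ∈ Finset.Ioc 0 N, if d ∣ j then 1 else 0)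
          * (∑ k ∈ Finset.Ioc 0 N, if d ∣ k then 1 else 0) * d ^ 2 := by
        simp_rw [Finset.sum_mul_sum, Finset.sum_mul]
        rw [Finset.sum_congr rfl fun j _ => Finset.sum_comm, Finset.sum_comm]
    _ = ∑ d ∈ Finset.Ioc 0 N, (N / d * d) ^ 2 := by
        refine Finset.sum_congr rfl fun d _ => ?_
        rw [← Finset.card_filter, Nat.Ioc_filter_dvd_card_eq_div]
        ring
    _ ≤ ∑ _d ∈ Finset.Ioc 0 N, N ^ 2 :=
        Finset.sum_le_sum fun d _ => Nat.pow_le_pow_left (Nat.div_mul_le_self N d) 2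
    _ = N ^ 3 := by simp; ring

/-- The block `∑_{M < k ≤ N} saw (k x) / k` of the series defining `φ_1`. -/
noncomputable def sawBlock (M N : ℕ) (x : ℝ) : ℝ :=
  ∑ k ∈ Finset.Ioc M N, saw (k * x) / k

@[fun_prop]
lemma measurable_sawBlock (M N : ℕ) : Measurable (sawBlock M N) := by
  unfold sawBlock
  fun_prop

lemma sawBlock_add_one (M N : ℕ) (x : ℝ) : sawBlock M N (x + 1) = sawBlock M N x := by
  simp only [sawBlock, mul_add, mul_one, saw_add_natCast]

lemma sawBlock_add_sawBlock {L M N : ℕ} (h : L ≤ M) (h' : M ≤ N) (x : ℝ) :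
    sawBlock L M x + sawBlock M N x = sawBlock L N x :=
  Finset.sum_Ioc_consecutive (fun k : ℕ => saw (k * x) / k) h h'

lemma abs_sawBlock_le (M N : ℕ) (x : ℝ) :
    |sawBlock M N x| ≤ ((N - M : ℕ) : ℝ) / (2 * M + 2) := by
  calc |sawBlock M N x| ≤ ∑ k ∈ Finset.Ioc M N, |saw (k * x) / k| := Finset.abs_sum_le_sum_abs _ _
    _ ≤ ∑ _k ∈ Finset.Ioc M N, 1 / (2 * (M : ℝ) + 2) := by
        refine Finset.sum_le_sum fun k hk => ?_
        have hk' : (M : ℝ) + 1 ≤ k := by exact_mod_cast (Finset.mem_Ioc.1 hk).1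
        have hM : (0 : ℝ) ≤ M := M.cast_nonneg
        rw [abs_div, abs_of_nonneg (by linarith : (0 : ℝ) ≤ k), div_le_div_iff₀ (by linarith)
          (by linarith)]
        have := abs_saw_le (k * x)
        nlinarith [abs_nonneg (saw (k * x))]
    _ = _ := by simp; ring

lemma integral_sawBlock_sq_le (M N : ℕ) (hM : 0 < M) :
    ∫ x in (0 : ℝ)..1, sawBlock M N x ^ 2 ≤ (N : ℝ) ^ 3 / (12 * (M : ℝ) ^ 4) := by
  have hM' : (0 : ℝ) < M := by exact_mod_cast hM
  have hint : ∀ j k : ℕ, IntervalIntegrable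
      (fun x : ℝ => saw (j * x) * saw (k * x) * (1 / (j * k))) volume 0 1 := by
    intro j k
    have := intervalIntegrable_saw_mul_saw j k 0 0 0 1
    simp only [add_zero] at this
    exact this.mul_const _
  have h1 : ∀ x, sawBlock M N x ^ 2 = ∑ j ∈ Finset.Ioc M N, ∑ k ∈ Finset.Ioc M N,
      saw (j * x) * saw (k * x) * (1 / (j * k)) := by
    intro x
    rw [sq, sawBlock, Finset.sum_mul_sum]
    refine Finset.sum_congr rfl fun j _ => Finset.sum_congr rfl fun k _ => ?_
    rw [div_mul_div_comm, div_eq_mul_one_div]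
  have h2 : ∫ x in (0 : ℝ)..1, sawBlock M N x ^ 2 = ∑ j ∈ Finset.Ioc M N, ∑ k ∈ Finset.Ioc M N,
      (j.gcd k : ℝ) ^ 2 / (12 * j * k) * (1 / (j * k)) := by
    simp_rw [h1]
    rw [intervalIntegral.integral_finsetSum (f := fun (j : ℕ) (x : ℝ) => ∑ k ∈ Finset.Ioc M N,
      saw (j * x) * saw (k * x) * (1 / (j * k))) fun j _ => by
        simpa [Finset.sum_fn] using IntervalIntegrable.sum (Finset.Ioc M N) fun k _ => hint j k]
    refine Finset.sum_congr rfl fun j hj => ?_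
    rw [intervalIntegral.integral_finsetSum fun k _ => hint j k]
    refine Finset.sum_congr rfl fun k hk => ?_
    rw [intervalIntegral.integral_mul_const, integral_saw_natCast_mul_mul_saw]
    · exact (Nat.zero_le _).trans_lt (Finset.mem_Ioc.1 hj).1
    · exact (Nat.zero_le _).trans_lt (Finset.mem_Ioc.1 hk).1
  have hsub : Finset.Ioc M N ⊆ Finset.Ioc 0 N := Finset.Ioc_subset_Ioc_left (Nat.zero_le _)
  calc ∫ x in (0 : ℝ)..1, sawBlock M N x ^ 2
      ≤ ∑ j ∈ Finset.Ioc M N, ∑ k ∈ Finset.Ioc M N,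
          (j.gcd k : ℝ) ^ 2 * (1 / (12 * (M : ℝ) ^ 4)) := by
        rw [h2]
        refine Finset.sum_le_sum fun j hj => Finset.sum_le_sum fun k hk => ?_
        have hj' : (M : ℝ) ≤ j := by exact_mod_cast (Finset.mem_Ioc.1 hj).1.le
        have hk' : (M : ℝ) ≤ k := by exact_mod_cast (Finset.mem_Ioc.1 hk).1.le
        have hj0 : (0 : ℝ) < j := hM'.trans_le hj'
        have hk0 : (0 : ℝ) < k := hM'.trans_le hk'
        rw [div_mul_div_comm, mul_one, div_eq_mul_one_div]
        refine mul_le_mul_of_nonneg_left (one_div_le_one_div_of_le (by positivity) ?_)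
          (by positivity)
        calc 12 * (M : ℝ) ^ 4 = 12 * M * M * (M * M) := by ring
          _ ≤ 12 * j * k * (j * k) := by gcongr
    _ ≤ ∑ j ∈ Finset.Ioc 0 N, ∑ k ∈ Finset.Ioc 0 N,
          (j.gcd k : ℝ) ^ 2 * (1 / (12 * (M : ℝ) ^ 4)) := by
        refine (Finset.sum_le_sum fun j _ => Finset.sum_le_sum_of_subset_of_nonneg hsub
          fun _ _ _ => by positivity).trans
          (Finset.sum_le_sum_of_subset_of_nonneg hsub fun _ _ _ => ?_)
        exact Finset.sum_nonneg fun _ _ => by positivity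
    _ ≤ (N : ℝ) ^ 3 * (1 / (12 * (M : ℝ) ^ 4)) := by
        simp_rw [← Finset.sum_mul]
        refine mul_le_mul_of_nonneg_right ?_ (by positivity)
        exact_mod_cast sum_gcd_sq_le N
    _ = _ := by ring

/-- Along fourth powers the `L¹` norms of the blocks are summable: the inequality
`2 |D| ≤ a + D ^ 2 / a` with `a = 1 / (m + 1) ^ 2` reduces this to the bound on squares. -/
lemma integral_abs_sawBlock_le (m : ℕ) :
    ∫ x in (0 : ℝ)..1, |sawBlock ((m + 1) ^ 4) ((m + 2) ^ 4) x| ≤ 200 / ((m : ℝ) + 1) ^ 2 := by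
  set M := (m + 1) ^ 4 with hM
  set N := (m + 2) ^ 4 with hN
  have hp : (0 : ℝ) < (m : ℝ) + 1 := by positivity
  have hmeas : Measurable (sawBlock M N) := measurable_sawBlock M N
  have hsq := integral_sawBlock_sq_le M N (by positivity)
  have hi : IntervalIntegrable (fun x => |sawBlock M N x|) volume 0 1 :=
    intervalIntegrable_of_measurable_of_abs_le (by fun_prop)
      (fun x => by rw [abs_abs]; exact abs_sawBlock_le M N x) 0 1
  have hi2 : IntervalIntegrable (fun x => sawBlock M N x ^ 2) volume 0 1 :=
    intervalIntegrable_of_measurable_of_abs_le (by fun_prop)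
      (fun x => by
        rw [abs_pow]
        exact pow_le_pow_left₀ (abs_nonneg _) (abs_sawBlock_le M N x) 2) 0 1
  -- As `N ≤ 16 M`, the mean square is at most `16 ^ 3 / (12 M)`, and `16 ^ 3 / 12 < 342`.
  have hbound : (N : ℝ) ^ 3 / (12 * (M : ℝ) ^ 4) ≤ 342 / ((m : ℝ) + 1) ^ 4 := by
    have h2 : (N : ℝ) ≤ 16 * M := by
      rw [hN, hM]
      push_cast
      calc ((m : ℝ) + 2) ^ 4 ≤ (2 * ((m : ℝ) + 1)) ^ 4 := by gcongr; linarith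
        _ = _ := by ring
    have hM' : (M : ℝ) = ((m : ℝ) + 1) ^ 4 := by rw [hM]; push_cast; ring
    have hM0 : (0 : ℝ) < M := by rw [hM']; positivity
    rw [← hM', div_le_div_iff₀ (by positivity) hM0]
    calc (N : ℝ) ^ 3 * M ≤ (16 * M) ^ 3 * M := by gcongr
      _ ≤ 342 * (12 * (M : ℝ) ^ 4) := by nlinarith [pow_pos hM0 4]
  calc ∫ x in (0 : ℝ)..1, |sawBlock M N x|
      ≤ ∫ x in (0 : ℝ)..1, (1 / (2 * ((m : ℝ) + 1) ^ 2)
          + ((m : ℝ) + 1) ^ 2 / 2 * sawBlock M N x ^ 2) := by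
        refine intervalIntegral.integral_mono_on zero_le_one hi
          (intervalIntegrable_const.add (hi2.const_mul _)) fun x _ => ?_
        rw [← sq_abs (sawBlock M N x)]
        have h := sq_nonneg (((m : ℝ) + 1) ^ 2 * |sawBlock M N x| - 1)
        have : 1 / (2 * ((m : ℝ) + 1) ^ 2) + ((m : ℝ) + 1) ^ 2 / 2 * |sawBlock M N x| ^ 2
            - |sawBlock M N x|
            = (((m : ℝ) + 1) ^ 2 * |sawBlock M N x| - 1) ^ 2 / (2 * ((m : ℝ) + 1) ^ 2) := by
          field_simp
          ring
        have h' := div_nonneg h (by positivity : (0 : ℝ) ≤ 2 * ((m : ℝ) + 1) ^ 2)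
        linarith
    _ = 1 / (2 * ((m : ℝ) + 1) ^ 2)
          + ((m : ℝ) + 1) ^ 2 / 2 * ∫ x in (0 : ℝ)..1, sawBlock M N x ^ 2 := by
        rw [intervalIntegral.integral_add intervalIntegrable_const (hi2.const_mul _),
          intervalIntegral.integral_const_mul]
        simp
    _ ≤ 1 / (2 * ((m : ℝ) + 1) ^ 2) + ((m : ℝ) + 1) ^ 2 / 2 * (342 / ((m : ℝ) + 1) ^ 4) := by
        gcongr
        exact hsq.trans hbound
    _ = (343 / 2) / ((m : ℝ) + 1) ^ 2 := by
        field_simp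
        norm_num
    _ ≤ _ := by gcongr; norm_num

/-! ### Almost everywhere convergence and the dominating function -/

lemma setLIntegral_Ioc_of_periodic {g : ℝ → ENNReal} (hg : Function.Periodic g 1) (a : ℝ) :
    ∫⁻ t in Set.Ioc a (a + 1), g t = ∫⁻ t in Set.Ioc (0 : ℝ) 1, g t := by
  have h := (isAddFundamentalDomain_Ioc zero_lt_one a volume).setLIntegral_eq
    (isAddFundamentalDomain_Ioc zero_lt_one 0 volume) g hg.map_vadd_zmultiples
  simpa using h

lemma summable_one_div_add_natCast_sq {lam : ℝ} (hlam : 0 < lam) :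
    Summable fun n : ℕ => 1 / (lam + n) ^ 2 := by
  refine (summable_nat_add_iff 1).1 ?_
  refine Summable.of_nonneg_of_le (fun n => by positivity) (fun n => ?_)
    ((summable_nat_add_iff 1).2 (Real.summable_one_div_nat_pow.2 one_lt_two))
  have : (0 : ℝ) < (n + 1 : ℕ) := by positivity
  gcongr
  linarith

/-- A periodic function with finite integral over a period is integrable against `dt / t ^ 2`
on every half-line `(lam, ∞)`, `lam > 0`. -/
lemma setLIntegral_Ioi_mul_one_div_sq_ne_top {g : ℝ → ENNReal} (hg : Function.Periodic g 1)
    (hfin : ∫⁻ t in Set.Ioc (0 : ℝ) 1, g t ≠ ⊤) {lam : ℝ} (hlam : 0 < lam) :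
    ∫⁻ t in Set.Ioi lam, g t * ENNReal.ofReal (1 / t ^ 2) ≠ ⊤ := by
  have hsub : Set.Ioi lam ⊆ ⋃ n : ℕ, Set.Ioc (lam + n) (lam + n + 1) := by
    intro t ht
    obtain ⟨n, ⟨hn1, hn2⟩, -⟩ := existsUnique_add_zsmul_mem_Ioc zero_lt_one t lam
    rw [zsmul_eq_mul, mul_one] at hn1 hn2
    have ht' : lam < t := ht
    have hn0 : n ≤ 0 := by
      by_contra hcon
      have : (1 : ℝ) ≤ n := by exact_mod_cast not_le.1 hcon
      linarith
    have hcast : ((n.natAbs : ℕ) : ℝ) = -(n : ℝ) := by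
      rw [Nat.cast_natAbs, abs_of_nonpos hn0]
      push_cast
      ring
    refine Set.mem_iUnion.2 ⟨n.natAbs, ?_, ?_⟩ <;> rw [hcast] <;> linarith
  have hpiece : ∀ n : ℕ, ∫⁻ t in Set.Ioc (lam + n) (lam + n + 1), g t * ENNReal.ofReal (1 / t ^ 2)
      ≤ (∫⁻ t in Set.Ioc (0 : ℝ) 1, g t) * ENNReal.ofReal (1 / (lam + n) ^ 2) := by
    intro n
    rw [← setLIntegral_Ioc_of_periodic hg (lam + n),
      ← lintegral_mul_const' _ _ ENNReal.ofReal_ne_top]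
    refine setLIntegral_mono' measurableSet_Ioc fun t ht => ?_
    have : 0 < lam + n := by positivity
    gcongr
    exact ht.1.le
  refine ne_top_of_le_ne_top ?_ ((lintegral_mono_set hsub).trans
    ((lintegral_iUnion_le _ _).trans (ENNReal.tsum_le_tsum hpiece)))
  rw [ENNReal.tsum_mul_left]
  exact ENNReal.mul_ne_top hfin (summable_one_div_add_natCast_sq hlam).tsum_ofReal_ne_top

/-- The sum of the absolute values of the blocks `n ^ 4 < k ≤ (n + 1) ^ 4`, `n ≥ 1`, of the series
defining `φ_1`. It dominates the partial sums, up to a constant. -/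
noncomputable def sawBlockSum (t : ℝ) : ENNReal :=
  ∑' m : ℕ, ‖sawBlock ((m + 1) ^ 4) ((m + 2) ^ 4) t‖ₑ

@[fun_prop]
lemma measurable_sawBlockSum : Measurable sawBlockSum :=
  Measurable.tsum fun _ => (measurable_sawBlock _ _).enorm

lemma periodic_sawBlockSum : Function.Periodic sawBlockSum 1 := fun t => by
  simp only [sawBlockSum, sawBlock_add_one]

lemma setLIntegral_sawBlockSum_ne_top : ∫⁻ t in Set.Ioc (0 : ℝ) 1, sawBlockSum t ≠ ⊤ := by
  have hsum : Summable fun m : ℕ => 200 / ((m : ℝ) + 1) ^ 2 := by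
    have h := ((summable_nat_add_iff 1).2 (Real.summable_one_div_nat_pow.2 one_lt_two)).mul_left
      (200 : ℝ)
    refine h.congr fun m => ?_
    push_cast
    ring
  unfold sawBlockSum
  rw [lintegral_tsum fun m => (measurable_sawBlock _ _).enorm.aemeasurable]
  refine ne_top_of_le_ne_top hsum.tsum_ofReal_ne_top (ENNReal.tsum_le_tsum fun m => ?_)
  have hint : IntegrableOn (sawBlock ((m + 1) ^ 4) ((m + 2) ^ 4)) (Set.Ioc 0 1) :=
    (intervalIntegrable_iff_integrableOn_Ioc_of_le zero_le_one).1
      (intervalIntegrable_of_measurable_of_abs_le (measurable_sawBlock _ _) (abs_sawBlock_le _ _)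
        0 1)
  rw [← ofReal_integral_norm_eq_lintegral_enorm hint]
  refine ENNReal.ofReal_le_ofReal ?_
  have h := integral_abs_sawBlock_le m
  rwa [intervalIntegral.integral_of_le zero_le_one] at h

lemma ae_sawBlockSum_ne_top : ∀ᵐ t : ℝ, sawBlockSum t ≠ ⊤ := by
  have h0 : ∀ᵐ t : ℝ, t ∈ Set.Ioc (0 : ℝ) 1 → sawBlockSum t ≠ ⊤ := by
    have := ae_lt_top' measurable_sawBlockSum.aemeasurable setLIntegral_sawBlockSum_ne_top
    filter_upwards [(ae_restrict_iff' measurableSet_Ioc).1 this] with t ht hmem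
    exact (ht hmem).ne
  have h1 : ∀ᵐ t : ℝ, ∀ n : ℤ, t + n ∈ Set.Ioc (0 : ℝ) 1 → sawBlockSum (t + n) ≠ ⊤ :=
    ae_all_iff.2 fun n => (measurePreserving_add_right volume (n : ℝ)).quasiMeasurePreserving.ae h0
  filter_upwards [h1] with t ht
  obtain ⟨n, hn, -⟩ := existsUnique_add_zsmul_mem_Ioc zero_lt_one t 0
  rw [zsmul_eq_mul, mul_one, zero_add] at hn
  have h2 := ht n hn
  rwa [show sawBlockSum (t + n) = sawBlockSum t by
    simpa using (periodic_sawBlockSum.int_mul n) t] at h2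

lemma sawBlock_zero_pow_four (m : ℕ) (t : ℝ) :
    sawBlock 0 ((m + 1) ^ 4) t
      = sawBlock 0 1 t + ∑ i ∈ Finset.range m, sawBlock ((i + 1) ^ 4) ((i + 2) ^ 4) t := by
  induction m with
  | zero => simp
  | succ m ih =>
    rw [Finset.sum_range_succ, ← add_assoc, ← ih, sawBlock_add_sawBlock (Nat.zero_le _)]
    exact Nat.pow_le_pow_left (by omega) 4

lemma abs_sawBlock_zero_one_le (t : ℝ) : |sawBlock 0 1 t| ≤ 1 / 2 := by
  simpa [sawBlock] using abs_saw_le t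

lemma abs_sawBlock_zero_pow_four_le {t : ℝ} (ht : sawBlockSum t ≠ ⊤) (m : ℕ) :
    |sawBlock 0 ((m + 1) ^ 4) t| ≤ 1 / 2 + (sawBlockSum t).toReal := by
  rw [sawBlock_zero_pow_four]
  refine (abs_add_le _ _).trans (add_le_add (abs_sawBlock_zero_one_le t) ?_)
  refine (Finset.abs_sum_le_sum_abs _ _).trans ?_
  have h : ∑ i ∈ Finset.range m, |sawBlock ((i + 1) ^ 4) ((i + 2) ^ 4) t|
      = (∑ i ∈ Finset.range m, ‖sawBlock ((i + 1) ^ 4) ((i + 2) ^ 4) t‖ₑ).toReal := by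
    rw [ENNReal.toReal_sum fun _ _ => enorm_ne_top]
    simp
  rw [h]
  exact ENNReal.toReal_mono ht (ENNReal.sum_le_tsum _)

lemma tendsto_sqrt_sqrt : Tendsto (fun K : ℕ => K.sqrt.sqrt) atTop atTop := by
  have h : Tendsto Nat.sqrt atTop atTop := by
    refine tendsto_atTop_atTop.2 fun b => ⟨b * b, fun a ha => Nat.le_sqrt.2 ha⟩
  exact h.comp h

/-- Between consecutive fourth powers the partial sums vary by `O(1 / n)`, so their convergence
along fourth powers implies convergence in the natural order. -/
lemma exists_tendsto_sawBlock_zero {t : ℝ} (ht : sawBlockSum t ≠ ⊤) :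
    ∃ l, Tendsto (fun K => sawBlock 0 K t) atTop (𝓝 l) := by
  have hsum : Summable fun m : ℕ => sawBlock ((m + 1) ^ 4) ((m + 2) ^ 4) t :=
    Summable.of_enorm ht
  have h4 : Tendsto (fun m : ℕ => sawBlock 0 (m ^ 4) t) atTop
      (𝓝 (sawBlock 0 1 t + ∑' m : ℕ, sawBlock ((m + 1) ^ 4) ((m + 2) ^ 4) t)) := by
    rw [← tendsto_add_atTop_iff_nat 1]
    simp only [sawBlock_zero_pow_four]
    exact tendsto_const_nhds.add hsum.hasSum.tendsto_sum_nat
  have hK := h4.comp tendsto_sqrt_sqrt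
  have hdiff : Tendsto (fun K : ℕ => sawBlock (K.sqrt.sqrt ^ 4) K t) atTop (𝓝 0) := by
    have hlim : Tendsto (fun K : ℕ => 15 * (1 / (K.sqrt.sqrt : ℝ))) atTop (𝓝 (15 * 0)) :=
      ((tendsto_one_div_atTop_nhds_zero_nat (𝕜 := ℝ)).comp tendsto_sqrt_sqrt).const_mul 15
    rw [mul_zero] at hlim
    refine squeeze_zero_norm' ?_ hlim
    filter_upwards [tendsto_sqrt_sqrt.eventually_ge_atTop 1] with K hq
    set q := K.sqrt.sqrt with hqdef
    have hlt : K < (q + 1) ^ 4 := by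
      have h1 : K.sqrt < (q + 1) ^ 2 := Nat.lt_succ_sqrt' _
      have h2 : K < (K.sqrt + 1) ^ 2 := Nat.lt_succ_sqrt' _
      calc K < (K.sqrt + 1) ^ 2 := h2
        _ ≤ ((q + 1) ^ 2) ^ 2 := Nat.pow_le_pow_left h1 2
        _ = _ := by ring
    have hle : q ^ 4 ≤ K := by
      calc q ^ 4 = (q ^ 2) ^ 2 := by ring
        _ ≤ K.sqrt ^ 2 := Nat.pow_le_pow_left (Nat.sqrt_le' _) 2
        _ ≤ K := Nat.sqrt_le' _
    refine (abs_sawBlock_le _ _ t).trans ?_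
    have hq' : (1 : ℝ) ≤ q := by exact_mod_cast hq
    -- `(q + 1) ^ 4 - q ^ 4 = 4 q ^ 3 + 6 q ^ 2 + 4 q + 1`, and the coefficients add up to `15`.
    have hnum : ((K - q ^ 4 : ℕ) : ℝ) ≤ 15 * (q : ℝ) ^ 3 := by
      have hlt' : (K : ℝ) < ((q : ℝ) + 1) ^ 4 := by exact_mod_cast hlt
      rw [Nat.cast_sub hle]
      push_cast
      have h1 : (q : ℝ) ≤ (q : ℝ) ^ 3 := le_self_pow₀ hq' (by norm_num)
      have h2 : (q : ℝ) ^ 2 ≤ (q : ℝ) ^ 3 := pow_le_pow_right₀ hq' (by norm_num)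
      have h3 : (1 : ℝ) ≤ (q : ℝ) ^ 3 := one_le_pow₀ hq'
      nlinarith
    have hq0 : (0 : ℝ) < q := by linarith
    push_cast
    rw [mul_one_div, div_le_div_iff₀ (by positivity) hq0]
    calc ((K - q ^ 4 : ℕ) : ℝ) * q ≤ 15 * (q : ℝ) ^ 3 * q := by gcongr
      _ ≤ 15 * (2 * (q : ℝ) ^ 4 + 2) := by nlinarith [pow_pos hq0 4]
  have hadd := hK.add hdiff
  rw [add_zero] at hadd
  refine ⟨_, hadd.congr fun K => ?_⟩
  refine sawBlock_add_sawBlock (Nat.zero_le _) ?_ t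
  calc K.sqrt.sqrt ^ 4 = (K.sqrt.sqrt ^ 2) ^ 2 := by ring
    _ ≤ K.sqrt ^ 2 := Nat.pow_le_pow_left (Nat.sqrt_le' _) 2
    _ ≤ K := Nat.sqrt_le' _

/-! ### Passage to the Bernoulli functions -/

lemma bernoulliPer_one_eq_saw {x : ℝ} (hx : Int.fract x ≠ 0) : bernoulliPer 1 x = saw x := by
  simp [bernoulliPer, hx, saw]

/-- At irrational points the value of `B_1` at the integers plays no role. -/
lemma phiPartial_one_eq_sawBlock {t : ℝ} (ht : Irrational t) (K : ℕ) :
    phiPartial 1 t K = sawBlock 0 K t := by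
  refine Finset.sum_congr rfl fun k hk => ?_
  have hk : k ≠ 0 := Nat.one_le_iff_ne_zero.1 (Finset.mem_Icc.1 hk).1
  have hirr : Irrational ((k : ℝ) * t) := ht.natCast_mul hk
  rw [bernoulliPer_one_eq_saw, pow_one]
  intro h
  obtain ⟨z, hz⟩ := Int.fract_eq_zero_iff.1 h
  exact hirr.ne_int z hz.symm

lemma ae_irrational : ∀ᵐ t : ℝ, Irrational t :=
  (Set.countable_range ((↑) : ℚ → ℝ)).ae_notMem volume

lemma ae_tendsto_sawBlock_phi_one :
    ∀ᵐ t : ℝ, Tendsto (fun K => sawBlock 0 K t) atTop (𝓝 (phi 1 t)) := by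
  filter_upwards [ae_irrational, ae_sawBlockSum_ne_top] with t hirr hfin
  have h := tendsto_nhds_limUnder (exists_tendsto_sawBlock_zero hfin)
  have heq : phi 1 t = limUnder atTop (fun K => sawBlock 0 K t) := by
    rw [phi]
    congr 1
    ext K
    exact phiPartial_one_eq_sawBlock hirr K
  rwa [heq]

lemma ae_tendsto_phiPartial_one :
    ∀ᵐ t : ℝ, Tendsto (phiPartial 1 t) atTop (𝓝 (phi 1 t)) := by
  filter_upwards [ae_irrational, ae_tendsto_sawBlock_phi_one] with t hirr ht
  exact ht.congr fun K => (phiPartial_one_eq_sawBlock hirr K).symm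

lemma integrableOn_one_div_pow {lam : ℝ} (hlam : 0 < lam) {n : ℕ} (hn : 2 ≤ n) :
    IntegrableOn (fun t : ℝ => 1 / t ^ n) (Set.Ioi lam) := by
  have hn' : (2 : ℝ) ≤ n := by exact_mod_cast hn
  refine (integrableOn_Ioi_rpow_of_lt (a := -(n : ℝ)) (by linarith) hlam).congr_fun
    (fun t ht => ?_) measurableSet_Ioi
  simp only [Real.rpow_neg (hlam.trans ht).le, Real.rpow_natCast, one_div]

lemma integrableOn_div_pow_of_abs_le {f : ℝ → ℝ} (hf : Measurable f) {C : ℝ}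
    (hC : ∀ x, |f x| ≤ C) {lam : ℝ} (hlam : 0 < lam) {n : ℕ} (hn : 2 ≤ n) :
    IntegrableOn (fun t => f t / t ^ n) (Set.Ioi lam) := by
  refine ((integrableOn_one_div_pow hlam hn).const_mul C).mono'
    (hf.div (by fun_prop)).aestronglyMeasurable
    ((ae_restrict_iff' measurableSet_Ioi).2 (Eventually.of_forall fun t ht => ?_))
  have : 0 < t := hlam.trans ht
  rw [Real.norm_eq_abs, abs_div, abs_of_pos (pow_pos this n), div_eq_mul_one_div]
  exact mul_le_mul_of_nonneg_right (hC t) (by positivity)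

/-- Dominated convergence for `φ_1` against `dt / t ^ 2`, along fourth powers. -/
lemma integrableOn_phi_one_and_tendsto {lam : ℝ} (hlam : 0 < lam) :
    IntegrableOn (fun t => phi 1 t / t ^ 2) (Set.Ioi lam) ∧
    Tendsto (fun m : ℕ => ∫ t in Set.Ioi lam, sawBlock 0 ((m + 1) ^ 4) t / t ^ 2) atTop
      (𝓝 (∫ t in Set.Ioi lam, phi 1 t / t ^ 2)) := by
  set b : ℝ → ℝ := fun t =>
    1 / 2 * (1 / t ^ 2) + (sawBlockSum t * ENNReal.ofReal (1 / t ^ 2)).toReal with hb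
  have hbint : IntegrableOn b (Set.Ioi lam) := by
    refine ((integrableOn_one_div_pow hlam le_rfl).const_mul _).add
      (integrable_toReal_of_lintegral_ne_top (by fun_prop) ?_)
    exact setLIntegral_Ioi_mul_one_div_sq_ne_top periodic_sawBlockSum
      setLIntegral_sawBlockSum_ne_top hlam
  have hmeas : ∀ m : ℕ, AEStronglyMeasurable (fun t => sawBlock 0 ((m + 1) ^ 4) t / t ^ 2)
      (volume.restrict (Set.Ioi lam)) := fun m =>
    ((measurable_sawBlock _ _).div (by fun_prop)).aestronglyMeasurable
  have hbound : ∀ m : ℕ, ∀ᵐ t ∂volume.restrict (Set.Ioi lam),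
      ‖sawBlock 0 ((m + 1) ^ 4) t / t ^ 2‖ ≤ b t := by
    intro m
    filter_upwards [ae_restrict_of_ae ae_sawBlockSum_ne_top] with t ht
    have h1 : 0 ≤ 1 / t ^ 2 := by positivity
    rw [Real.norm_eq_abs, div_eq_mul_one_div, abs_mul, abs_of_nonneg h1, hb]
    simp only [ENNReal.toReal_mul, ENNReal.toReal_ofReal h1, ← add_mul]
    exact mul_le_mul_of_nonneg_right (abs_sawBlock_zero_pow_four_le ht m) h1
  have hlim : ∀ᵐ t ∂volume.restrict (Set.Ioi lam),
      Tendsto (fun m : ℕ => sawBlock 0 ((m + 1) ^ 4) t / t ^ 2) atTop (𝓝 (phi 1 t / t ^ 2)) := by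
    filter_upwards [ae_restrict_of_ae ae_tendsto_sawBlock_phi_one] with t ht
    have hpow : Tendsto (fun m : ℕ => (m + 1) ^ 4) atTop atTop :=
      (tendsto_pow_atTop (by norm_num)).comp (tendsto_add_atTop_nat 1)
    exact (ht.comp hpow).div_const _
  refine ⟨hbint.mono' (aestronglyMeasurable_of_tendsto_ae _ hmeas hlim) ?_,
    tendsto_integral_of_dominated_convergence b hmeas hbint hbound hlim⟩
  filter_upwards [ae_all_iff.2 hbound, hlim] with t h1 h2
  exact le_of_tendsto h2.norm (Eventually.of_forall h1)

/-! ### The series `φ_2` -/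

lemma bernoulliPer_two (x : ℝ) :
    bernoulliPer 2 x = Int.fract x ^ 2 - Int.fract x + 6⁻¹ := by
  simp [bernoulliPer]

lemma continuous_bernoulliPer_two : Continuous (bernoulliPer 2) := by
  have h : bernoulliPer 2 = (fun x : ℝ => x ^ 2 - x + 6⁻¹) ∘ Int.fract := by
    ext x
    exact bernoulliPer_two x
  rw [h]
  exact ContinuousOn.comp_fract'' (by fun_prop) (by norm_num)

lemma abs_bernoulliPer_two_le (x : ℝ) : |bernoulliPer 2 x| ≤ 1 / 6 := by
  have h0 := Int.fract_nonneg x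
  have h1 := Int.fract_lt_one x
  rw [bernoulliPer_two, abs_le]
  constructor <;> nlinarith [sq_nonneg (Int.fract x - 1 / 2)]

lemma hasDerivAt_bernoulliPer_two {x : ℝ} (hx : Int.fract x ≠ 0) :
    HasDerivAt (bernoulliPer 2) (2 * saw x) x := by
  have hlt : (⌊x⌋ : ℝ) < x := by
    have := (Int.fract_nonneg x).lt_of_ne hx.symm
    rw [Int.fract] at this
    linarith
  have heq : bernoulliPer 2 =ᶠ[𝓝 x] fun y => (y - ⌊x⌋) ^ 2 - (y - ⌊x⌋) + 6⁻¹ := by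
    filter_upwards [Ioo_mem_nhds hlt (Int.lt_floor_add_one x)] with y hy
    have hfl : ⌊y⌋ = ⌊x⌋ := Int.floor_eq_iff.2 ⟨hy.1.le, hy.2⟩
    rw [bernoulliPer_two, Int.fract, hfl]
  have hd : HasDerivAt (fun y : ℝ => (y - ⌊x⌋) ^ 2 - (y - ⌊x⌋) + 6⁻¹) (2 * saw x) x := by
    have h1 := (hasDerivAt_id x).sub_const (⌊x⌋ : ℝ)
    refine (((h1.pow 2).sub h1).add_const 6⁻¹).congr_deriv ?_
    rw [saw, ← Int.self_sub_floor]
    simp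
    ring
  exact hd.congr_of_eventuallyEq heq

lemma phiPartial_eq_sum_range (n : ℕ) (x : ℝ) (K : ℕ) : phiPartial n x K =
    ∑ i ∈ Finset.range K, bernoulliPer n (((i + 1 : ℕ) : ℝ) * x) / ((i + 1 : ℕ) : ℝ) ^ n := by
  induction K with
  | zero => simp [phiPartial]
  | succ K ih =>
    rw [Finset.sum_range_succ, ← ih, phiPartial, Finset.sum_Icc_succ_top (by omega), phiPartial]

lemma abs_phi_two_term_le (i : ℕ) (x : ℝ) :
    |bernoulliPer 2 (((i + 1 : ℕ) : ℝ) * x) / ((i + 1 : ℕ) : ℝ) ^ 2|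
      ≤ 1 / 6 * (1 / ((i + 1 : ℕ) : ℝ) ^ 2) := by
  rw [abs_div, abs_of_nonneg (by positivity : (0 : ℝ) ≤ ((i + 1 : ℕ) : ℝ) ^ 2), div_eq_mul_one_div]
  exact mul_le_mul_of_nonneg_right (abs_bernoulliPer_two_le _) (by positivity)

lemma summable_one_sixth_div_succ_sq :
    Summable fun i : ℕ => 1 / 6 * (1 / ((i + 1 : ℕ) : ℝ) ^ 2) :=
  ((summable_nat_add_iff 1).2 (Real.summable_one_div_nat_pow.2 one_lt_two)).mul_left _

lemma tendsto_phiPartial_two (t : ℝ) : Tendsto (phiPartial 2 t) atTop (𝓝 (phi 2 t)) := by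
  have hsum : Summable fun i : ℕ =>
      bernoulliPer 2 (((i + 1 : ℕ) : ℝ) * t) / ((i + 1 : ℕ) : ℝ) ^ 2 :=
    Summable.of_norm_bounded summable_one_sixth_div_succ_sq fun i => abs_phi_two_term_le i t
  refine tendsto_nhds_limUnder ⟨_, hsum.hasSum.tendsto_sum_nat.congr fun K => ?_⟩
  exact (phiPartial_eq_sum_range 2 t K).symm

lemma abs_phiPartial_two_le (t : ℝ) (K : ℕ) :
    |phiPartial 2 t K| ≤ ∑' i : ℕ, 1 / 6 * (1 / ((i + 1 : ℕ) : ℝ) ^ 2) := by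
  rw [phiPartial_eq_sum_range]
  refine (Finset.abs_sum_le_sum_abs _ _).trans
    ((Finset.sum_le_sum fun i _ => abs_phi_two_term_le i t).trans ?_)
  exact summable_one_sixth_div_succ_sq.sum_le_tsum _ fun i _ => by positivity

lemma measurable_phiPartial_two (K : ℕ) : Measurable fun t => phiPartial 2 t K := by
  have h := continuous_bernoulliPer_two
  refine Continuous.measurable ?_
  unfold phiPartial
  fun_prop

lemma integrableOn_phi_two_and_tendsto {lam : ℝ} (hlam : 0 < lam) :
    IntegrableOn (fun t => phi 2 t / t ^ 3) (Set.Ioi lam) ∧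
    Tendsto (fun K : ℕ => ∫ t in Set.Ioi lam, phiPartial 2 t K / t ^ 3) atTop
      (𝓝 (∫ t in Set.Ioi lam, phi 2 t / t ^ 3)) := by
  set C : ℝ := ∑' i : ℕ, 1 / 6 * (1 / ((i + 1 : ℕ) : ℝ) ^ 2)
  have hbint : IntegrableOn (fun t : ℝ => C * (1 / t ^ 3)) (Set.Ioi lam) :=
    (integrableOn_one_div_pow hlam (by norm_num)).const_mul _
  have hmeas : ∀ K : ℕ, AEStronglyMeasurable (fun t => phiPartial 2 t K / t ^ 3)
      (volume.restrict (Set.Ioi lam)) := fun K =>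
    ((measurable_phiPartial_two K).div (by fun_prop)).aestronglyMeasurable
  have hbound : ∀ K : ℕ, ∀ᵐ t ∂volume.restrict (Set.Ioi lam),
      ‖phiPartial 2 t K / t ^ 3‖ ≤ C * (1 / t ^ 3) := by
    intro K
    refine (ae_restrict_iff' measurableSet_Ioi).2 (Eventually.of_forall fun t ht => ?_)
    have : 0 < t := hlam.trans ht
    rw [Real.norm_eq_abs, abs_div, abs_of_pos (pow_pos this 3), div_eq_mul_one_div]
    exact mul_le_mul_of_nonneg_right (abs_phiPartial_two_le t K) (by positivity)
  have hlim : ∀ᵐ t ∂volume.restrict (Set.Ioi lam),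
      Tendsto (fun K : ℕ => phiPartial 2 t K / t ^ 3) atTop (𝓝 (phi 2 t / t ^ 3)) :=
    Eventually.of_forall fun t => (tendsto_phiPartial_two t).div_const _
  refine ⟨hbint.mono' (aestronglyMeasurable_of_tendsto_ae _ hmeas hlim) ?_,
    tendsto_integral_of_dominated_convergence _ hmeas hbint hbound hlim⟩
  filter_upwards [ae_all_iff.2 hbound, hlim] with t h1 h2
  exact le_of_tendsto h2.norm (Eventually.of_forall h1)

/-! ### Tail integrals of the sawtooth -/

/-- The tail integral `∫_y^∞ ({u} - 1 / 2) u ^ (-2) du`. -/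
noncomputable def sawTail (y : ℝ) : ℝ := ∫ u in Set.Ioi y, saw u / u ^ 2

lemma integral_Ioi_one_div_pow {y : ℝ} (hy : 0 < y) {n : ℕ} (hn : 0 < n) :
    ∫ u in Set.Ioi y, 1 / u ^ (n + 1) = 1 / (n * y ^ n) := by
  have hn' : (0 : ℝ) < n := by exact_mod_cast hn
  have h := integral_Ioi_rpow_of_lt (a := -((n + 1 : ℕ) : ℝ)) (by push_cast; linarith) hy
  have h1 : ∫ u in Set.Ioi y, 1 / u ^ (n + 1)
      = ∫ u in Set.Ioi y, u ^ (-((n + 1 : ℕ) : ℝ)) := by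
    refine setIntegral_congr_fun measurableSet_Ioi fun u hu => ?_
    simp only [Real.rpow_neg (hy.trans hu).le, Real.rpow_natCast, one_div]
  rw [h1, h, show -((n + 1 : ℕ) : ℝ) + 1 = -(n : ℝ) by push_cast; ring, Real.rpow_neg hy.le,
    Real.rpow_natCast]
  field_simp

lemma integral_Ioi_comp_mul_div_pow (f : ℝ → ℝ) (lam : ℝ) {k : ℕ} (hk : 0 < k) (n : ℕ) :
    ∫ t in Set.Ioi lam, f (k * t) / (k : ℝ) ^ n / t ^ (n + 1)
      = ∫ u in Set.Ioi (k * lam), f u / u ^ (n + 1) := by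
  have hk' : (0 : ℝ) < k := by exact_mod_cast hk
  have h := integral_comp_mul_left_Ioi (fun u => f u / u ^ (n + 1)) lam hk'
  have h1 : ∀ t : ℝ, f (k * t) / (k : ℝ) ^ n / t ^ (n + 1)
      = k * (f (k * t) / (k * t) ^ (n + 1)) := by
    intro t
    rw [mul_pow, div_div, pow_succ (k : ℝ) n,
      show (k : ℝ) ^ n * k * t ^ (n + 1) = k * ((k : ℝ) ^ n * t ^ (n + 1)) by ring,
      ← div_div (f (k * t)) (k : ℝ), ← mul_div_assoc, mul_div_cancel₀ _ hk'.ne']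
  simp_rw [h1]
  rw [integral_const_mul, h, smul_eq_mul, mul_inv_cancel_left₀ hk'.ne']

lemma integral_sawBlock_div_sq {lam : ℝ} (hlam : 0 < lam) (K : ℕ) :
    ∫ t in Set.Ioi lam, sawBlock 0 K t / t ^ 2
      = ∑ k ∈ Finset.Ioc 0 K, sawTail (k * lam) := by
  simp_rw [sawBlock, Finset.sum_div]
  rw [integral_finsetSum]
  · refine Finset.sum_congr rfl fun k hk => ?_
    have := integral_Ioi_comp_mul_div_pow saw lam (Finset.mem_Ioc.1 hk).1 1
    rw [pow_one] at this
    exact this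
  · intro k _
    have hm : Measurable fun t : ℝ => saw (k * t) := by fun_prop
    have := (integrableOn_div_pow_of_abs_le hm (fun x => abs_saw_le _) hlam le_rfl).mul_const
      (1 / (k : ℝ))
    refine this.congr (Eventually.of_forall fun t => ?_)
    simp only
    ring

lemma integral_phiPartial_two_div_cube {lam : ℝ} (hlam : 0 < lam) (K : ℕ) :
    ∫ t in Set.Ioi lam, phiPartial 2 t K / t ^ 3
      = ∑ k ∈ Finset.Ioc 0 K, ∫ u in Set.Ioi (k * lam), bernoulliPer 2 u / u ^ 3 := by
  simp_rw [phiPartial, Finset.sum_div]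
  rw [integral_finsetSum]
  · refine Finset.sum_congr rfl fun k hk => ?_
    exact integral_Ioi_comp_mul_div_pow (bernoulliPer 2) lam (Finset.mem_Icc.1 hk).1 2
  · intro k _
    have hm : Measurable fun t : ℝ => bernoulliPer 2 (k * t) :=
      (continuous_bernoulliPer_two.comp (by fun_prop)).measurable
    have := (integrableOn_div_pow_of_abs_le hm (fun x => abs_bernoulliPer_two_le _) hlam
      (n := 3) (by norm_num)).mul_const (1 / (k : ℝ) ^ 2)
    refine this.congr (Eventually.of_forall fun t => ?_)
    simp only
    ring

/-- Integration by parts, with `B_2 / 2` as the primitive of the sawtooth. -/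
lemma sawTail_eq {y : ℝ} (hy : 0 < y) : sawTail y =
    -(bernoulliPer 2 y / (2 * y ^ 2)) + ∫ u in Set.Ioi y, bernoulliPer 2 u / u ^ 3 := by
  set F : ℝ → ℝ := fun u => bernoulliPer 2 u / (2 * u ^ 2) with hF
  have h1 : IntegrableOn (fun u => saw u / u ^ 2) (Set.Ioi y) :=
    integrableOn_div_pow_of_abs_le measurable_saw abs_saw_le hy le_rfl
  have h2 : IntegrableOn (fun u => bernoulliPer 2 u / u ^ 3) (Set.Ioi y) :=
    integrableOn_div_pow_of_abs_le continuous_bernoulliPer_two.measurable abs_bernoulliPer_two_le hy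
      (by norm_num)
  have hint : IntegrableOn (fun u => saw u / u ^ 2 - bernoulliPer 2 u / u ^ 3) (Set.Ioi y) :=
    h1.sub h2
  have hfin : ∀ X, y ≤ X →
      ∫ u in y..X, (saw u / u ^ 2 - bernoulliPer 2 u / u ^ 3) = F X - F y := by
    intro X hX
    refine integral_eq_of_hasDerivAt_off_countable F _
      (s := Set.range ((↑) : ℤ → ℝ)) (Set.countable_range _) ?_ ?_ ?_
    · rw [Set.uIcc_of_le hX]
      refine continuous_bernoulliPer_two.continuousOn.div (by fun_prop) fun u hu => ?_
      have : 0 < u := hy.trans_le hu.1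
      positivity
    · rintro u ⟨hu, hnot⟩
      rw [min_eq_left hX] at hu
      have hu0 : 0 < u := hy.trans hu.1
      have hfr : Int.fract u ≠ 0 := fun h => hnot <| by
        obtain ⟨z, hz⟩ := Int.fract_eq_zero_iff.1 h
        exact ⟨z, hz⟩
      have hd := (hasDerivAt_bernoulliPer_two hfr).div (((hasDerivAt_id u).pow 2).const_mul 2)
        (by simp [hu0.ne'])
      refine hd.congr_deriv ?_
      simp
      field_simp
    · rw [intervalIntegrable_iff_integrableOn_Ioc_of_le hX]
      exact hint.mono_set Set.Ioc_subset_Ioi_self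
  have hlim := intervalIntegral_tendsto_integral_Ioi y hint tendsto_id
  have hF0 : Tendsto F atTop (𝓝 0) := by
    have h0 : Tendsto (fun u : ℝ => 1 / 12 * (u ^ 2)⁻¹) atTop (𝓝 (1 / 12 * 0)) :=
      (tendsto_inv_atTop_zero.comp (tendsto_pow_atTop two_ne_zero)).const_mul _
    rw [mul_zero] at h0
    refine squeeze_zero_norm (fun u => ?_) h0
    rw [Real.norm_eq_abs, hF, abs_div, abs_of_nonneg (by positivity : (0 : ℝ) ≤ 2 * u ^ 2),
      div_eq_mul_inv, mul_inv, ← mul_assoc]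
    refine mul_le_mul_of_nonneg_right ?_ (by positivity)
    linarith [abs_bernoulliPer_two_le u]
  have hlim' : Tendsto (fun X => ∫ u in y..id X, (saw u / u ^ 2 - bernoulliPer 2 u / u ^ 3)) atTop
      (𝓝 (0 - F y)) := by
    refine (hF0.sub_const (F y)).congr' ?_
    filter_upwards [eventually_ge_atTop y] with X hX
    exact (hfin X hX).symm
  have huniq := tendsto_nhds_unique hlim hlim'
  rw [integral_sub h1 h2] at huniq
  rw [sawTail]
  linarith

lemma abs_sawTail_le {y : ℝ} (hy : 0 < y) : |sawTail y| ≤ 1 / (6 * y ^ 2) := by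
  rw [sawTail_eq hy]
  have h1 : |bernoulliPer 2 y / (2 * y ^ 2)| ≤ 1 / 6 / (2 * y ^ 2) := by
    rw [abs_div, abs_of_pos (by positivity : 0 < 2 * y ^ 2)]
    gcongr
    exact abs_bernoulliPer_two_le y
  have h2 : |∫ u in Set.Ioi y, bernoulliPer 2 u / u ^ 3| ≤ 1 / 6 * (1 / (2 * y ^ 2)) := by
    have h3 := integral_Ioi_one_div_pow hy (n := 2) (by norm_num)
    norm_num only at h3
    rw [← h3, ← integral_const_mul, ← Real.norm_eq_abs]
    refine norm_integral_le_of_norm_le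
      ((integrableOn_one_div_pow hy (n := 3) (by norm_num)).const_mul _)
      ((ae_restrict_iff' measurableSet_Ioi).2 (Eventually.of_forall fun u hu => ?_))
    have : 0 < u := hy.trans hu
    rw [Real.norm_eq_abs, abs_div, abs_of_pos (pow_pos this 3), div_eq_mul_one_div]
    exact mul_le_mul_of_nonneg_right (abs_bernoulliPer_two_le u) (by positivity)
  refine (abs_add_le _ _).trans ?_
  rw [abs_neg]
  refine (add_le_add h1 h2).trans (le_of_eq ?_)
  field_simp
  norm_num

lemma integrableOn_fract_div_sq {y : ℝ} (hy : 0 < y) :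
    IntegrableOn (fun u : ℝ => Int.fract u / u ^ 2) (Set.Ioi y) :=
  integrableOn_div_pow_of_abs_le measurable_fract
    (fun x => by rw [Int.abs_fract]; exact (Int.fract_lt_one x).le) hy le_rfl

lemma integral_Ioi_fract_div_sq {y : ℝ} (hy : 0 < y) :
    ∫ u in Set.Ioi y, Int.fract u / u ^ 2 = sawTail y + 1 / (2 * y) := by
  have h1 := integral_Ioi_one_div_pow hy (n := 1) (by norm_num)
  norm_num only at h1
  have h2 : ∀ u : ℝ, Int.fract u / u ^ 2 = saw u / u ^ 2 + 1 / 2 * (1 / u ^ 2) := by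
    intro u
    rw [saw]
    ring
  simp_rw [h2]
  rw [integral_add (integrableOn_div_pow_of_abs_le measurable_saw abs_saw_le hy le_rfl)
    ((integrableOn_one_div_pow hy le_rfl).const_mul _), integral_const_mul, h1, sawTail]
  field_simp

/-! ### The asymptotics of `∫ {u} / u du` -/

lemma abs_fract_div_self_le {u : ℝ} (hu : 0 ≤ u) : |Int.fract u / u| ≤ 1 := by
  rw [abs_div, Int.abs_fract, abs_of_nonneg hu]
  refine div_le_one_of_le₀ ?_ hu
  have : (0 : ℝ) ≤ ⌊u⌋ := by exact_mod_cast Int.floor_nonneg.2 hu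
  linarith [Int.floor_add_fract u]

lemma intervalIntegrable_fract_div_self {a b : ℝ} (ha : 0 ≤ a) (hab : a ≤ b) :
    IntervalIntegrable (fun u : ℝ => Int.fract u / u) volume a b := by
  refine (intervalIntegrable_const (c := (1 : ℝ))).mono_fun
    (measurable_fract.div measurable_id).aestronglyMeasurable ?_
  rw [Set.uIoc_of_le hab]
  refine (ae_restrict_iff' measurableSet_Ioc).2 (Eventually.of_forall fun u hu => ?_)
  simp only [Real.norm_eq_abs, abs_one]
  exact abs_fract_div_self_le (ha.trans hu.1.le)

lemma integral_fract_div_self_natCast_succ (n : ℕ) :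
    ∫ u in (n : ℝ)..(n + 1 : ℕ), Int.fract u / u
      = 1 - n * (Real.log (n + 1 : ℕ) - Real.log n) := by
  have hle : (n : ℝ) ≤ (n + 1 : ℕ) := by push_cast; linarith
  have hcongr : ∫ u in (n : ℝ)..(n + 1 : ℕ), Int.fract u / u
      = ∫ u in (n : ℝ)..(n + 1 : ℕ), (1 - n * (1 / u)) := by
    refine intervalIntegral.integral_congr_ae ?_
    have h1 : ∀ᵐ u : ℝ, u ≠ (n + 1 : ℕ) := by simp [ae_iff]
    filter_upwards [h1] with u hu hmem
    rw [Set.uIoc_of_le hle] at hmem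
    have hu0 : 0 < u := (Nat.cast_nonneg n).trans_lt hmem.1
    have hlt : u < (n : ℝ) + 1 := by
      have := lt_of_le_of_ne hmem.2 hu
      push_cast at this
      exact this
    have hfl : ⌊u⌋ = (n : ℤ) := Int.floor_eq_iff.2 ⟨by simpa using hmem.1.le, by simpa using hlt⟩
    rw [Int.fract, hfl]
    field_simp
    simp
  rw [hcongr]
  rcases Nat.eq_zero_or_pos n with rfl | hn
  · simp
  · have hn' : (0 : ℝ) < n := by exact_mod_cast hn
    have hnot : (0 : ℝ) ∉ Set.uIcc (n : ℝ) (n + 1 : ℕ) := by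
      rw [Set.uIcc_of_le hle]
      exact fun h => absurd h.1 (not_le.2 hn')
    rw [intervalIntegral.integral_sub intervalIntegrable_const
      ((intervalIntegral.intervalIntegrable_one_div
        (fun u hu => ne_of_mem_of_not_mem hu hnot) continuousOn_id).const_mul _),
      intervalIntegral.integral_const_mul, integral_one_div hnot,
      Real.log_div (by positivity) hn'.ne']
    simp

lemma integral_fract_div_self_natCast (N : ℕ) :
    ∫ u in (0 : ℝ)..N, Int.fract u / u = N - N * Real.log N + Real.log N.factorial := by
  induction N with
  | zero => simp
  | succ n ih =>
    rw [← intervalIntegral.integral_add_adjacent_intervals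
      (intervalIntegrable_fract_div_self le_rfl n.cast_nonneg)
      (intervalIntegrable_fract_div_self n.cast_nonneg (by push_cast; linarith)), ih,
      integral_fract_div_self_natCast_succ, Nat.factorial_succ, Nat.cast_mul,
      Real.log_mul (by positivity) (by positivity)]
    push_cast
    ring

/-- Stirling's formula in integral form. -/
lemma tendsto_integral_fract_div_self_natCast :
    Tendsto (fun N : ℕ => (∫ u in (0 : ℝ)..N, Int.fract u / u) - 1 / 2 * Real.log N) atTop
      (𝓝 (1 / 2 * Real.log (2 * Real.pi))) := by
  have h := (Stirling.tendsto_stirlingSeq_sqrt_pi.log (by positivity)).add_const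
    (1 / 2 * Real.log 2)
  have hval : Real.log (√Real.pi) + 1 / 2 * Real.log 2 = 1 / 2 * Real.log (2 * Real.pi) := by
    rw [Real.log_sqrt Real.pi_pos.le, Real.log_mul two_ne_zero Real.pi_ne_zero]
    ring
  rw [hval] at h
  refine h.congr' ?_
  filter_upwards [eventually_ge_atTop 1] with N hN
  have hN' : (0 : ℝ) < N := by exact_mod_cast hN
  rw [integral_fract_div_self_natCast, Stirling.log_stirlingSeq_formula,
    Real.log_mul two_ne_zero hN'.ne', Real.log_div hN'.ne' (Real.exp_pos 1).ne', Real.log_exp]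
  ring

lemma tendsto_integral_fract_div_self :
    Tendsto (fun X : ℝ => (∫ u in (0 : ℝ)..X, Int.fract u / u) - 1 / 2 * Real.log X) atTop
      (𝓝 (1 / 2 * Real.log (2 * Real.pi))) := by
  have h := tendsto_integral_fract_div_self_natCast.comp (tendsto_nat_floor_atTop (α := ℝ))
  have herr : Tendsto (fun X : ℝ => (∫ u in (⌊X⌋₊ : ℝ)..X, Int.fract u / u)
      - 1 / 2 * (Real.log X - Real.log ⌊X⌋₊)) atTop (𝓝 0) := by
    have hlim : Tendsto (fun X : ℝ => 3 / 2 * (1 / (⌊X⌋₊ : ℝ))) atTop (𝓝 (3 / 2 * 0)) :=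
      ((tendsto_one_div_atTop_nhds_zero_nat (𝕜 := ℝ)).comp
        (tendsto_nat_floor_atTop (α := ℝ))).const_mul _
    rw [mul_zero] at hlim
    refine squeeze_zero_norm' ?_ hlim
    filter_upwards [eventually_ge_atTop 1] with X hX
    have hN : 1 ≤ ⌊X⌋₊ := Nat.one_le_floor_iff X |>.2 hX
    have hN' : (0 : ℝ) < (⌊X⌋₊ : ℝ) := by exact_mod_cast hN
    have hle : (⌊X⌋₊ : ℝ) ≤ X := Nat.floor_le (by linarith)
    have hlt : X < ⌊X⌋₊ + 1 := Nat.lt_floor_add_one X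
    have h1 : |∫ u in (⌊X⌋₊ : ℝ)..X, Int.fract u / u| ≤ 1 / (⌊X⌋₊ : ℝ) := by
      rw [← Real.norm_eq_abs]
      refine (intervalIntegral.norm_integral_le_of_norm_le_const
        (C := 1 / (⌊X⌋₊ : ℝ)) fun u hu => ?_).trans ?_
      · rw [Set.uIoc_of_le hle] at hu
        have hu0 : 0 < u := hN'.trans hu.1
        rw [Real.norm_eq_abs, abs_div, Int.abs_fract, abs_of_pos hu0]
        exact div_le_div₀ zero_le_one (Int.fract_lt_one u).le hN' hu.1.le
      · rw [abs_of_nonneg (by linarith)]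
        exact mul_le_of_le_one_right (by positivity) (by linarith)
    have h2 : |Real.log X - Real.log ⌊X⌋₊| ≤ 1 / (⌊X⌋₊ : ℝ) := by
      rw [abs_of_nonneg (sub_nonneg.2 (Real.log_le_log hN' hle)),
        ← Real.log_div (by linarith) hN'.ne']
      refine (Real.log_le_sub_one_of_pos (by positivity)).trans ?_
      rw [div_sub_one hN'.ne']
      gcongr
      linarith
    rw [Real.norm_eq_abs]
    refine (abs_sub _ _).trans ?_
    rw [abs_mul, abs_of_pos (by norm_num : (0 : ℝ) < 1 / 2)]
    linarith
  have hadd := h.add herr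
  rw [add_zero] at hadd
  refine hadd.congr' ?_
  filter_upwards [eventually_ge_atTop 0] with X hX
  have hle : (⌊X⌋₊ : ℝ) ≤ X := Nat.floor_le hX
  rw [Function.comp_apply, ← intervalIntegral.integral_add_adjacent_intervals
    (intervalIntegrable_fract_div_self le_rfl (Nat.cast_nonneg ⌊X⌋₊))
    (intervalIntegrable_fract_div_self (Nat.cast_nonneg ⌊X⌋₊) hle)]
  ring

/-! ### The autocorrelation as a sum of tails -/

lemma integrableOn_fract_mul_fract {lam : ℝ} (hlam : 0 < lam) :
    IntegrableOn (fun t : ℝ => Int.fract t * Int.fract (lam * t) / t ^ 2) (Set.Ioi 0) := by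
  have hm : Measurable fun t : ℝ => Int.fract t * Int.fract (lam * t) :=
    measurable_fract.mul (measurable_fract.comp (measurable_const_mul lam))
  have hfr : ∀ u : ℝ, 0 ≤ u → Int.fract u ≤ u := fun u hu => by
    have : (0 : ℝ) ≤ ⌊u⌋ := by exact_mod_cast Int.floor_nonneg.2 hu
    linarith [Int.floor_add_fract u]
  rw [← Set.Ioc_union_Ioi_eq_Ioi (zero_le_one (α := ℝ)), integrableOn_union]
  constructor
  · refine (integrableOn_const (C := lam) (by simp)).mono'
      (hm.div (by fun_prop)).aestronglyMeasurable
      ((ae_restrict_iff' measurableSet_Ioc).2 (Eventually.of_forall fun t ht => ?_))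
    have ht0 : 0 < t := ht.1
    rw [Real.norm_eq_abs, abs_div, abs_mul, Int.abs_fract, Int.abs_fract,
      abs_of_pos (pow_pos ht0 2), div_le_iff₀ (pow_pos ht0 2)]
    calc Int.fract t * Int.fract (lam * t) ≤ t * (lam * t) :=
          mul_le_mul (hfr t ht0.le) (hfr _ (by positivity)) (Int.fract_nonneg _) ht0.le
      _ = lam * t ^ 2 := by ring
  · refine integrableOn_div_pow_of_abs_le hm (C := 1) (fun t => ?_) one_pos le_rfl
    rw [abs_mul, Int.abs_fract, Int.abs_fract]
    exact mul_le_one₀ (Int.fract_lt_one _).le (Int.fract_nonneg _) (Int.fract_lt_one _).le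

/-- The substitution `t = u / lam`. -/
lemma fractAutocorr_eq {lam : ℝ} (hlam : 0 < lam) :
    IntegrableOn (fun u : ℝ => Int.fract u * Int.fract (u / lam) / u ^ 2) (Set.Ioi 0) ∧
    fractAutocorr lam
      = lam * ∫ u in Set.Ioi (0 : ℝ), Int.fract u * Int.fract (u / lam) / u ^ 2 := by
  have hcomp : ∀ t : ℝ, Int.fract t * Int.fract (lam * t) / t ^ 2 =
      lam ^ 2 * (Int.fract (lam * t) * Int.fract (lam * t / lam) / (lam * t) ^ 2) := by
    intro t
    rw [mul_div_cancel_left₀ _ hlam.ne', mul_pow, ← mul_div_assoc,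
      mul_div_mul_left _ _ (by positivity), mul_comm (Int.fract t)]
  constructor
  · have h := integrableOn_fract_mul_fract hlam
    simp_rw [hcomp] at h
    have h' := (integrable_const_mul_iff (by simp [hlam.ne'] : IsUnit (lam ^ 2)) _).1 h
    rw [← IntegrableOn, integrableOn_Ioi_comp_mul_left_iff
      (fun u => Int.fract u * Int.fract (u / lam) / u ^ 2) 0 hlam, mul_zero] at h'
    exact h'
  · have h := integral_comp_mul_left_Ioi
      (fun u => Int.fract u * Int.fract (u / lam) / u ^ 2) 0 hlam
    rw [fractAutocorr]
    simp_rw [hcomp]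
    rw [integral_const_mul, h, mul_zero, smul_eq_mul]
    field_simp

/-- On `(K lam, (K + 1) lam)` the fractional part of `u / lam` is `u / lam - K`. -/
lemma integral_fract_mul_fract_step {lam : ℝ} (hlam : 0 < lam) (K : ℕ) :
    lam * ∫ u in (K * lam)..((K + 1 : ℕ) * lam), Int.fract u * Int.fract (u / lam) / u ^ 2
      = (∫ u in (K * lam)..((K + 1 : ℕ) * lam), Int.fract u / u)
        - K * lam * ((∫ u in Set.Ioi (K * lam), Int.fract u / u ^ 2)
          - ∫ u in Set.Ioi ((K + 1 : ℕ) * lam), Int.fract u / u ^ 2) := by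
  have hle : K * lam ≤ (K + 1 : ℕ) * lam := by push_cast; linarith
  have hcongr : lam * ∫ u in (K * lam)..((K + 1 : ℕ) * lam),
        Int.fract u * Int.fract (u / lam) / u ^ 2
      = ∫ u in (K * lam)..((K + 1 : ℕ) * lam),
        (Int.fract u / u - K * lam * (Int.fract u / u ^ 2)) := by
    rw [← intervalIntegral.integral_const_mul]
    refine intervalIntegral.integral_congr_ae ?_
    have h1 : ∀ᵐ u : ℝ, u ≠ (K + 1 : ℕ) * lam := by simp [ae_iff]
    filter_upwards [h1] with u hu hmem
    rw [Set.uIoc_of_le hle] at hmem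
    have hu0 : 0 < u := lt_of_le_of_lt (by positivity) hmem.1
    have hlt := lt_of_le_of_ne hmem.2 hu
    push_cast at hlt
    have hfl : ⌊u / lam⌋ = (K : ℤ) := by
      refine Int.floor_eq_iff.2 ⟨?_, ?_⟩
      · rw [le_div_iff₀ hlam]
        exact_mod_cast hmem.1.le
      · rw [div_lt_iff₀ hlam]
        exact_mod_cast hlt
    rw [Int.fract.eq_1 (u / lam), hfl]
    field_simp
    push_cast
    ring
  rw [hcongr]
  -- For `K = 0` the divergent integral over `(0, ∞)` carries the factor `0`.
  rcases Nat.eq_zero_or_pos K with rfl | hK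
  · simp
  · have hK' : (0 : ℝ) < K * lam := mul_pos (by exact_mod_cast hK) hlam
    have hint := integrableOn_fract_div_sq hK'
    rw [intervalIntegral.integral_Ioi_sub_Ioi hint hle,
      intervalIntegral.integral_sub (intervalIntegrable_fract_div_self hK'.le hle),
      intervalIntegral.integral_const_mul]
    exact (((intervalIntegrable_iff_integrableOn_Ioc_of_le hle).2
      (hint.mono_set Set.Ioc_subset_Ioi_self)).const_mul _)

lemma integral_fract_mul_fract_truncated {lam : ℝ} (hlam : 0 < lam) (K : ℕ) :
    lam * ∫ u in (0 : ℝ)..(K * lam), Int.fract u * Int.fract (u / lam) / u ^ 2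
      = (∫ u in (0 : ℝ)..(K * lam), Int.fract u / u)
        - lam * ∑ k ∈ Finset.Ioc 0 K, (∫ u in Set.Ioi (k * lam), Int.fract u / u ^ 2)
        + K * lam * ∫ u in Set.Ioi (K * lam), Int.fract u / u ^ 2 := by
  induction K with
  | zero => simp
  | succ K ih =>
    have hle : K * lam ≤ (K + 1 : ℕ) * lam := by push_cast; linarith
    have hK : 0 ≤ K * lam := by positivity
    have hint : ∀ a b : ℝ, 0 ≤ a → a ≤ b → IntervalIntegrable
        (fun u : ℝ => Int.fract u * Int.fract (u / lam) / u ^ 2) volume a b := fun a b ha hab =>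
      (intervalIntegrable_iff_integrableOn_Ioc_of_le hab).2
        ((fractAutocorr_eq hlam).1.mono_set fun u hu => ha.trans_lt hu.1)
    rw [← intervalIntegral.integral_add_adjacent_intervals (hint _ _ le_rfl hK) (hint _ _ hK hle),
      ← intervalIntegral.integral_add_adjacent_intervals
        (intervalIntegrable_fract_div_self le_rfl hK) (intervalIntegrable_fract_div_self hK hle),
      mul_add, ih, integral_fract_mul_fract_step hlam,
      Finset.sum_Ioc_succ_top (Nat.zero_le K)]
    push_cast
    ring

/-- Truncating the autocorrelation at `u = K lam` and letting `K → ∞`: the logarithms of Stirling's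
formula and of the harmonic numbers leave `log lam`, `log 2π` and Euler's constant. -/
lemma tendsto_sum_sawTail {lam : ℝ} (hlam : 0 < lam) :
    Tendsto (fun K : ℕ => lam * ∑ k ∈ Finset.Ioc 0 K, sawTail (k * lam)) atTop
      (𝓝 (1 / 2 * Real.log lam
          + (1 - Real.eulerMascheroniConstant + Real.log (2 * Real.pi)) / 2
          - fractAutocorr lam)) := by
  have hKlam : Tendsto (fun K : ℕ => (K : ℝ) * lam) atTop atTop :=
    tendsto_natCast_atTop_atTop.atTop_mul_const hlam
  have hA : Tendsto (fun K : ℕ => lam * ∫ u in (0 : ℝ)..(K * lam),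
      Int.fract u * Int.fract (u / lam) / u ^ 2) atTop (𝓝 (fractAutocorr lam)) := by
    obtain ⟨hint, heq⟩ := fractAutocorr_eq hlam
    rw [heq]
    exact (intervalIntegral_tendsto_integral_Ioi 0 hint hKlam).const_mul lam
  have hP := tendsto_integral_fract_div_self.comp hKlam
  have hH := Real.tendsto_harmonic_sub_log.const_mul (1 / 2 : ℝ)
  have hT : Tendsto (fun K : ℕ => K * lam * sawTail (K * lam)) atTop (𝓝 0) := by
    have h0 : Tendsto (fun K : ℕ => 1 / 6 * ((K : ℝ) * lam)⁻¹) atTop (𝓝 (1 / 6 * 0)) :=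
      (tendsto_inv_atTop_zero.comp hKlam).const_mul _
    rw [mul_zero] at h0
    refine squeeze_zero_norm' ?_ h0
    filter_upwards [eventually_ge_atTop 1] with K hK
    have hK' : (0 : ℝ) < K * lam := mul_pos (by exact_mod_cast hK) hlam
    rw [Real.norm_eq_abs, abs_mul, abs_of_pos hK']
    refine (mul_le_mul_of_nonneg_left (abs_sawTail_le hK') hK'.le).trans (le_of_eq ?_)
    field_simp
  have hall := ((((hP.sub hH).add hT).add_const (1 / 2 + 1 / 2 * Real.log lam)).sub hA)
  convert hall.congr' ?_ using 2
  · ring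
  · filter_upwards [eventually_ge_atTop 1] with K hK
    have hK0 : (0 : ℝ) < K := by exact_mod_cast hK
    have hK' : (0 : ℝ) < K * lam := mul_pos hK0 hlam
    have hsum : lam * ∑ k ∈ Finset.Ioc 0 K, (∫ u in Set.Ioi (k * lam), Int.fract u / u ^ 2)
        = lam * ∑ k ∈ Finset.Ioc 0 K, sawTail (k * lam) + 1 / 2 * (harmonic K : ℝ) := by
      have hharm : (harmonic K : ℝ) = ∑ k ∈ Finset.Ioc 0 K, ((k : ℝ))⁻¹ := by
        rw [harmonic_eq_sum_Icc]
        push_cast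
        rfl
      rw [hharm, Finset.mul_sum, Finset.mul_sum, Finset.mul_sum, ← Finset.sum_add_distrib]
      refine Finset.sum_congr rfl fun k hk => ?_
      have hk0 : (0 : ℝ) < k := by exact_mod_cast (Finset.mem_Ioc.1 hk).1
      rw [integral_Ioi_fract_div_sq (mul_pos hk0 hlam)]
      field_simp
    rw [integral_fract_mul_fract_truncated hlam, hsum, integral_Ioi_fract_div_sq hK']
    simp only [Function.comp_apply]
    rw [Real.log_mul hK0.ne' hlam.ne']
    field_simp
    ring

/-! ### The two formulas -/

theorem mainTheorem4 :
    -- the series defining `φ_1` converges almost everywhere, that of `φ_2` everywhere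
    (∀ᵐ t : ℝ, Tendsto (phiPartial 1 t) atTop (𝓝 (phi 1 t))) ∧
    (∀ t : ℝ, Tendsto (phiPartial 2 t) atTop (𝓝 (phi 2 t))) ∧
    ∀ lam : ℝ, 0 < lam →
      -- the three integrals converge absolutely
      IntegrableOn (fun t : ℝ => Int.fract t * Int.fract (lam * t) / t ^ 2) (Set.Ioi 0) ∧
      IntegrableOn (fun t : ℝ => phi 1 t / t ^ 2) (Set.Ioi lam) ∧
      IntegrableOn (fun t : ℝ => phi 2 t / t ^ 3) (Set.Ioi lam) ∧
      -- the two formulas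
      fractAutocorr lam =
        1 / 2 * Real.log lam
          + (1 - Real.eulerMascheroniConstant + Real.log (2 * Real.pi)) / 2
          - lam * ∫ t in Set.Ioi lam, phi 1 t / t ^ 2 ∧
      fractAutocorr lam =
        1 / 2 * Real.log lam
          + (1 - Real.eulerMascheroniConstant + Real.log (2 * Real.pi)) / 2
          + phi 2 lam / (2 * lam)
          - lam * ∫ t in Set.Ioi lam, phi 2 t / t ^ 3 := by
  refine ⟨ae_tendsto_phiPartial_one, tendsto_phiPartial_two, fun lam hlam => ?_⟩
  obtain ⟨hint1, hlim1⟩ := integrableOn_phi_one_and_tendsto hlam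
  obtain ⟨hint2, hlim2⟩ := integrableOn_phi_two_and_tendsto hlam
  have hmain := tendsto_sum_sawTail hlam
  refine ⟨integrableOn_fract_mul_fract hlam, hint1, hint2, ?_, ?_⟩
  · have hpow : Tendsto (fun m : ℕ => (m + 1) ^ 4) atTop atTop :=
      (tendsto_pow_atTop (by norm_num)).comp (tendsto_add_atTop_nat 1)
    simp_rw [integral_sawBlock_div_sq hlam] at hlim1
    have h := tendsto_nhds_unique (hmain.comp hpow) (hlim1.const_mul lam)
    linarith
  · simp_rw [integral_phiPartial_two_div_cube hlam] at hlim2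
    have h2 := ((tendsto_phiPartial_two lam).const_mul (-(1 / (2 * lam)))).add
      (hlim2.const_mul lam)
    have h3 : ∀ K : ℕ, -(1 / (2 * lam)) * phiPartial 2 lam K
        + lam * ∑ k ∈ Finset.Ioc 0 K, (∫ u in Set.Ioi (k * lam), bernoulliPer 2 u / u ^ 3)
        = lam * ∑ k ∈ Finset.Ioc 0 K, sawTail (k * lam) := by
      intro K
      rw [phiPartial, show Finset.Icc 1 K = Finset.Ioc 0 K from rfl, Finset.mul_sum,
        Finset.mul_sum, Finset.mul_sum, ← Finset.sum_add_distrib]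
      refine Finset.sum_congr rfl fun k hk => ?_
      have hk0 : (0 : ℝ) < k := by exact_mod_cast (Finset.mem_Ioc.1 hk).1
      rw [sawTail_eq (mul_pos hk0 hlam)]
      field_simp
    have h := tendsto_nhds_unique hmain (h2.congr h3)
    have h4 : -(1 / (2 * lam)) * phi 2 lam = -(phi 2 lam / (2 * lam)) := by ring
    rw [h4] at h
    linarith
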